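/- \textbf{Theorem (Dichotomy).} Let $\mathcal H$ be a real Hilbert space, let $I$ be a nonempty finite or countably infinite index set, and for each $i\in I$ let $M_i\neq\{0\}$ be a closed linear subspace of $\mathcal H$, with orthogonal projection $P_{M_i}$. Let $M:=\bigcap_{i\in I} M_i$, with orthogonal projection $P_M$. Let $\Omega$ be the set of all families $\omega=(\omega_i)_{i\in I}$ with $\omega_i>0$ for all $i$ and $\sum_{i\in I}\omega_i=1$. For $\omega\in\Omega$ put $$\mathbf H_\omega:=\Big\{\mathbf x=(x_i)_{i\in I}\colon x_i\in\mathcal H,\ \sum_{i\in I}\omega_i\|x_i\|^2<\infty\Big\},\qquad \langle \mathbf x,\mathbf y\rangle_\omega:=\sum_{i\in I}\omega_i\langle x_i,y_i\rangle,$$ $$A_\omega(\mathbf x):=\sum_{i\in I}\omega_i x_i\quad(\mathbf x\in\mathbf H_\omega),\qquad T_\omega(x):=\sum_{i\in I}\omega_iP_{M_i}(x)\quad(x\in\mathcal H),$$ $$\mathbf C_\omega:=\{\mathbf x\in\mathbf H_\omega\colon x_i\in M_i\ \text{for all } i\in I\},\qquad \mathbf D_\omega:=\{(x)_{i\in I}\colon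 x\in\mathcal H\}.$$ Let $\mathbf C_\omega^\perp$ be the orthogonal complement in $\mathbf H_\omega$, and let $$\cos_\omega(\mathbf C_\omega,\mathbf D_\omega):=\sup\big\{\langle\mathbf x,\mathbf y\rangle_\omega\colon \mathbf x\in\mathbf C_\omega\cap(\mathbf C_\omega\cap\mathbf D_\omega)^\perp,\ \mathbf y\in\mathbf D_\omega\cap(\mathbf C_\omega\cap\mathbf D_\omega)^\perp,\ \|\mathbf x\|_\omega\le1,\ \|\mathbf y\|_\omega\le1\big\}$$ be the cosine of the Friedrichs angle. Say that $T_\omega^k\to P_M$ \emph{linearly} if there are $c>0$ and $q\in(0,1)$ with $\|T_\omega^k(x)-P_M(x)\|\le c\,q^k\|x\|$ for all $k\ge1$ and all $x\in\mathcal H$; and \emph{arbitrarily slowly} if $T_\omega^k(x)\to P_M(x)$ for every $x\in\mathcal H$ and, for every sequence $a_k\ge0$ with $a_k\to0$, there is $x\in\mathcal H$ such that $\|T_\omega^k(x)-P_M(x)\|\ge a_k$ for all $k\ge1$. Then exactly one of the following two cases holds. (i) For all $\omega\in\Omega$ the set $A_\omega(\mathbf C_\omega^\perp)$ is closed in $\mathcal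 H$. In this case, for every $\omega\in\Omega$, $T_\omega^k\to P_M$ linearly, and for every $k\ge1$ and all $x\in\mathcal H$, $$\|T_\omega^k(x)-P_M(x)\|\le\cos_\omega(\mathbf C_\omega,\mathbf D_\omega)^{2k}\,\|x\|,$$ where $\cos_\omega(\mathbf C_\omega,\mathbf D_\omega)^{2k}$ is the smallest constant for which this holds for all $x\in\mathcal H$. (ii) For all $\omega\in\Omega$ the set $A_\omega(\mathbf C_\omega^\perp)$ is not closed in $\mathcal H$. In this case, for every $\omega\in\Omega$, $T_\omega^k\to P_M$ arbitrarily slowly. Consequently the type of convergence does not depend on the weights: either $T_\omega^k\to P_M$ linearly for all $\omega\in\Omega$, or $T_\omega^k\to P_M$ arbitrarily slowly for all $\omega\in\Omega$, but not both. -/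

import Mathlib

open Filter Topology

noncomputable section

namespace SimProj

/-- The set `Ω` of weights on `ι`: families of strictly positive reals with sum `1`. The index
type is `Fin r` for finitely many subspaces and `ℕ` for infinitely many. -/
def Weights (ι : Type*) : Set (ι → ℝ) :=
  {ω | (∀ i, 0 < ω i) ∧ HasSum ω 1}

variable {ι : Type*} {H : Type*} [NormedAddCommGroup H] [InnerProductSpace ℝ H]

lemma Weights.pos (ω : Weights ι) (i : ι) : 0 < ω.1 i := ω.2.1 i

lemma Weights.summable (ω : Weights ι) : Summable ω.1 := ω.2.2.summable

/-- The families `(x i)` in `H` with `∑ ω i ‖x i‖² < ∞`, as a linear subspace of `ι → H`. -/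
def ellTwo (H : Type*) [NormedAddCommGroup H] [InnerProductSpace ℝ H] (ω : Weights ι) :
    Submodule ℝ (ι → H) where
  carrier := {x | Summable fun i => ω.1 i * ‖x i‖ ^ 2}
  zero_mem' := by simp [summable_zero]
  add_mem' := by
    intro x y hx hy
    refine Summable.of_nonneg_of_le (fun i => ?_) (fun i => ?_) ((hx.add hy).mul_left 2)
    · exact mul_nonneg (Weights.pos ω i).le (sq_nonneg _)
    · have h1 : ‖(x + y) i‖ ^ 2 ≤ 2 * (‖x i‖ ^ 2 + ‖y i‖ ^ 2) := by
        have h2 : ‖(x + y) i‖ ≤ ‖x i‖ + ‖y i‖ := norm_add_le _ _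
        nlinarith [norm_nonneg ((x + y) i), sq_nonneg (‖x i‖ - ‖y i‖)]
      nlinarith [Weights.pos ω i, mul_le_mul_of_nonneg_left h1 (Weights.pos ω i).le]
  smul_mem' := by
    intro c x hx
    refine (Summable.mul_left (c ^ 2) hx).congr fun i => ?_
    simp only [Pi.smul_apply, norm_smul, mul_pow, Real.norm_eq_abs, sq_abs]
    ring

/-- The weighted product space `H_ω`. It is a type of its own so that it carries only the
weighted inner product, and not the supremum norm of a finite product. -/
def Hw (H : Type*) [NormedAddCommGroup H] [InnerProductSpace ℝ H] (ω : Weights ι) : Type _ :=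
  ellTwo H ω

namespace Hw

variable {ω : Weights ι}

instance : AddCommGroup (Hw H ω) := inferInstanceAs (AddCommGroup (ellTwo H ω))

instance : Module ℝ (Hw H ω) := inferInstanceAs (Module ℝ (ellTwo H ω))

instance : CoeFun (Hw H ω) (fun _ => ι → H) := ⟨fun x => x.1⟩

@[simp] lemma add_apply (x y : Hw H ω) (i : ι) : (x + y) i = x i + y i := rfl

@[simp] lemma smul_apply (c : ℝ) (x : Hw H ω) (i : ι) : (c • x) i = c • x i := rfl

@[simp] lemma zero_apply (i : ι) : (0 : Hw H ω) i = 0 := rfl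

lemma summable_sq (x : Hw H ω) : Summable fun i => ω.1 i * ‖x i‖ ^ 2 := x.2

lemma summable_inner (x y : Hw H ω) : Summable fun i => ω.1 i * inner ℝ (x i) (y i) := by
  refine Summable.of_norm_bounded ((summable_sq x).add (summable_sq y)) fun i => ?_
  have h1 := abs_real_inner_le_norm (x i) (y i)
  have h2 : |inner ℝ (x i) (y i)| ≤ ‖x i‖ ^ 2 + ‖y i‖ ^ 2 := by
    nlinarith [sq_nonneg (‖x i‖ - ‖y i‖), sq_nonneg ‖x i‖, sq_nonneg ‖y i‖]
  rw [Real.norm_eq_abs, abs_mul, abs_of_pos (Weights.pos ω i), ← mul_add]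
  exact mul_le_mul_of_nonneg_left h2 (Weights.pos ω i).le

/-- The weighted inner product `⟨x, y⟩_ω = ∑ ω i ⟨x i, y i⟩`. -/
abbrev core (H : Type*) [NormedAddCommGroup H] [InnerProductSpace ℝ H] (ω : Weights ι) :
    InnerProductSpace.Core ℝ (Hw H ω) where
  inner x y := ∑' i, ω.1 i * inner ℝ (x i) (y i)
  conj_inner_symm x y := by
    simp only [conj_trivial]
    exact tsum_congr fun i => by rw [real_inner_comm]
  re_inner_nonneg x := by
    simp only [RCLike.re_to_real]
    exact tsum_nonneg fun i => mul_nonneg (Weights.pos ω i).le real_inner_self_nonneg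
  add_left x y z := by
    rw [← (summable_inner x z).tsum_add (summable_inner y z)]
    exact tsum_congr fun i => by rw [add_apply, inner_add_left, mul_add]
  smul_left x y c := by
    simp only [conj_trivial]
    rw [← tsum_mul_left]
    exact tsum_congr fun i => by rw [smul_apply, real_inner_smul_left]; ring
  definite x hx := by
    have hn : ∀ i, 0 ≤ ω.1 i * inner ℝ (x i) (x i) := fun i =>
      mul_nonneg (Weights.pos ω i).le real_inner_self_nonneg
    have h0 := (hasSum_zero_iff_of_nonneg hn).1 (hx ▸ (summable_inner x x).hasSum)
    refine Subtype.ext (funext fun i => ?_)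
    have hi : ω.1 i * inner ℝ (x i) (x i) = 0 := congrFun h0 i
    have := (mul_eq_zero.1 hi).resolve_left (Weights.pos ω i).ne'
    exact inner_self_eq_zero.1 this

instance : NormedAddCommGroup (Hw H ω) := (core H ω).toNormedAddCommGroup

instance : InnerProductSpace ℝ (Hw H ω) := InnerProductSpace.ofCore (core H ω).toCore

lemma inner_def (x y : Hw H ω) : inner ℝ x y = ∑' i, ω.1 i * inner ℝ (x i) (y i) := rfl

end Hw

lemma summable_smul_of_bound [CompleteSpace H] (ω : Weights ι) {x : ι → H}
    (hx : Summable fun i => ω.1 i * ‖x i‖ ^ 2) : Summable fun i => ω.1 i • x i := by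
  refine Summable.of_norm_bounded ((Weights.summable ω).add hx) fun i => ?_
  rw [norm_smul, Real.norm_eq_abs, abs_of_pos (Weights.pos ω i)]
  nlinarith [Weights.pos ω i, mul_nonneg (Weights.pos ω i).le (sq_nonneg (‖x i‖ - 1)),
    mul_nonneg (Weights.pos ω i).le (norm_nonneg (x i))]

/-- The averaging operator `A_ω x = ∑ ω i x i` from `H_ω` to `H`. -/
def averaging [CompleteSpace H] (ω : Weights ι) : Hw H ω →ₗ[ℝ] H where
  toFun x := ∑' i, ω.1 i • x i
  map_add' x y := by
    rw [← (summable_smul_of_bound ω x.2).tsum_add (summable_smul_of_bound ω y.2)]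
    exact tsum_congr fun i => by rw [Hw.add_apply, smul_add]
  map_smul' c x := by
    rw [RingHom.id_apply, ← (summable_smul_of_bound ω x.2).tsum_const_smul]
    exact tsum_congr fun i => by rw [Hw.smul_apply, smul_comm]

/-- The subspace `C_ω = H_ω ∩ ∏ M i`. -/
def prodSubspace (M : ι → ClosedSubmodule ℝ H) (ω : Weights ι) : Submodule ℝ (Hw H ω) where
  carrier := {x | ∀ i, x i ∈ M i}
  zero_mem' i := (M i).zero_mem
  add_mem' hx hy i := (M i).add_mem (hx i) (hy i)
  smul_mem' c _ hx i := (M i).smul_mem c (hx i)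

/-- The diagonal subspace `D_ω` of constant families. -/
def diagSubspace (H : Type*) [NormedAddCommGroup H] [InnerProductSpace ℝ H] (ω : Weights ι) :
    Submodule ℝ (Hw H ω) where
  carrier := {x | ∃ h : H, ∀ i, x i = h}
  zero_mem' := ⟨0, fun _ => rfl⟩
  add_mem' := by
    rintro x y ⟨a, ha⟩ ⟨b, hb⟩
    exact ⟨a + b, fun i => by rw [Hw.add_apply, ha, hb]⟩
  smul_mem' := by
    rintro c x ⟨a, ha⟩
    exact ⟨c • a, fun i => by rw [Hw.smul_apply, ha]⟩

/-- The cosine of the Friedrichs angle between two subspaces of a real inner product space. -/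
def friedrichsCos {E : Type*} [NormedAddCommGroup E] [InnerProductSpace ℝ E]
    (U V : Submodule ℝ E) : ℝ :=
  sSup {t : ℝ | ∃ x ∈ U ⊓ (U ⊓ V)ᗮ, ∃ y ∈ V ⊓ (U ⊓ V)ᗮ, ‖x‖ ≤ 1 ∧ ‖y‖ ≤ 1 ∧ t = inner ℝ x y}

/-- The set `A_ω(C_ω^⊥)`. -/
def goodSet [CompleteSpace H] (M : ι → ClosedSubmodule ℝ H) (ω : Weights ι) : Set H :=
  averaging ω '' ((prodSubspace M ω)ᗮ : Set (Hw H ω))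

lemma summable_proj [CompleteSpace H] (M : ι → ClosedSubmodule ℝ H) (ω : Weights ι) (x : H) :
    Summable fun i => ω.1 i • (M i).toSubmodule.starProjection x := by
  refine summable_smul_of_bound ω ?_
  refine Summable.of_nonneg_of_le (fun i => mul_nonneg (Weights.pos ω i).le (sq_nonneg _))
    (fun i => ?_) ((Weights.summable ω).mul_right (‖x‖ ^ 2))
  exact mul_le_mul_of_nonneg_left (pow_le_pow_left₀ (norm_nonneg _)
    ((M i).toSubmodule.norm_starProjection_apply_le x) 2) (Weights.pos ω i).le

/-- The simultaneous projection operator `T_ω x = ∑ ω i P_{M i} x`. -/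
def simProj [CompleteSpace H] (M : ι → ClosedSubmodule ℝ H) (ω : Weights ι) : H →ₗ[ℝ] H where
  toFun x := ∑' i, ω.1 i • (M i).toSubmodule.starProjection x
  map_add' x y := by
    rw [← (summable_proj M ω x).tsum_add (summable_proj M ω y)]
    exact tsum_congr fun i => by rw [map_add, smul_add]
  map_smul' c x := by
    rw [RingHom.id_apply, ← (summable_proj M ω x).tsum_const_smul]
    exact tsum_congr fun i => by rw [map_smul, smul_comm]

/-- The orthogonal projection onto the intersection of the `M i`. -/
def projInter [CompleteSpace H] (M : ι → ClosedSubmodule ℝ H) : H →L[ℝ] H :=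
  (⨅ i, M i).toSubmodule.starProjection

/-- The powers of `T` converge linearly (geometrically, uniformly on bounded sets) to `P`. -/
def ConvergesLinearly (T P : H →ₗ[ℝ] H) : Prop :=
  ∃ c : ℝ, 0 < c ∧ ∃ q : ℝ, 0 < q ∧ q < 1 ∧
    ∀ k : ℕ, 1 ≤ k → ∀ x : H, ‖(T ^ k) x - P x‖ ≤ c * q ^ k * ‖x‖

/-- The powers of `T` converge pointwise to `P`, but arbitrarily slowly: every null sequence of
nonnegative reals is a lower bound for the error at some starting point. -/
def ConvergesArbitrarilySlowly (T P : H →ₗ[ℝ] H) : Prop :=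
  (∀ x : H, Tendsto (fun k : ℕ => (T ^ k) x) atTop (𝓝 (P x))) ∧
  ∀ a : ℕ → ℝ, (∀ k, 0 ≤ a k) → Tendsto a atTop (𝓝 0) →
    ∃ x : H, ∀ k : ℕ, 1 ≤ k → a k ≤ ‖(T ^ k) x - P x‖

end SimProj

end

/-! Write Q h = (P_{M i} h)_i, so that T_ω = Q*Q, and let R = T_ω - P_M. Everything is decided by
one inequality, `HasGap`: on M^⊥ the quantity ∑ ω i ‖h - P_{M i} h‖² = ⟨h - T_ω h, h⟩ dominates a
multiple of ‖h‖².

The gap is equivalent to closedness of A_ω(C_ω^⊥). This is the closed range theorem: h ↦ (h - P_{M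
i} h)_i is, on M^⊥, the adjoint of A_ω : C_ω^⊥ → M^⊥. The gap does not depend on ω, because finitely
many indices carry almost all of the mass and any two weights are comparable on a finite set
(`HasGap.of_hasGap`).

With a gap, ‖R‖ < 1 and convergence is linear. Moreover ‖R‖ = ‖Q|M^⊥‖² is the squared Friedrichs
cosine, and ‖R^k‖ = ‖R‖^k by self-adjointness. Without a gap there are unit vectors almost fixed by
R. They are weakly null because R has no nonzero fixed point, and a gliding-hump series of them
decays as slowly as desired (`exists_forall_le_norm_pow_apply`). -/

namespace SimProj

/-! ### Orbits of symmetric contractions without nonzero fixed points -/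

section Contraction

variable {H : Type*} [NormedAddCommGroup H] [InnerProductSpace ℝ H]

lemma norm_apply_le_of_norm_sq_le_inner {R : H →ₗ[ℝ] H}
    (hR : ∀ x, ‖R x‖ ^ 2 ≤ inner ℝ (R x) x) (x : H) : ‖R x‖ ≤ ‖x‖ := by
  have h1 := (hR x).trans (real_inner_le_norm (R x) x)
  rcases (norm_nonneg (R x)).eq_or_lt with h0 | h0
  · rw [← h0]; exact norm_nonneg x
  · nlinarith

lemma norm_pow_apply_le {R : H →ₗ[ℝ] H} (hR : ∀ x, ‖R x‖ ≤ ‖x‖) (k : ℕ) (x : H) :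
    ‖(R ^ k) x‖ ≤ ‖x‖ := by
  induction k with
  | zero => simp
  | succ k ih =>
    rw [pow_succ', Module.End.mul_apply]
    exact (hR _).trans ih

lemma norm_sub_apply_sq_le {R : H →ₗ[ℝ] H}
    (hR : ∀ x, ‖R x‖ ^ 2 ≤ inner ℝ (R x) x) (x : H) :
    ‖x - R x‖ ^ 2 ≤ ‖x‖ ^ 2 - ‖R x‖ ^ 2 := by
  rw [norm_sub_sq_real, real_inner_comm]
  linarith [hR x]

/-- If `R` is symmetric without nonzero fixed points, then `1 - R` has dense range. -/
lemma exists_norm_sub_lt_of_symmetric [CompleteSpace H] {R : H →ₗ[ℝ] H} (hsym : R.IsSymmetric)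
    (hker : ∀ x, R x = x → x = 0) (f : H) {ε : ℝ} (hε : 0 < ε) :
    ∃ g, ‖f - (g - R g)‖ < ε := by
  have htop : (LinearMap.range (LinearMap.id - R)).topologicalClosure = ⊤ := by
    rw [Submodule.topologicalClosure_eq_top_iff, Submodule.eq_bot_iff]
    intro x hx
    refine hker x (sub_eq_zero.1 ?_).symm
    -- Testing x against (1 - R)(x - R x) gives ‖x - R x‖² = 0 by symmetry.
    have h := (Submodule.mem_orthogonal _ _).1 hx (x - R x - R (x - R x)) ⟨x - R x, rfl⟩
    rw [inner_sub_left, hsym, ← inner_sub_right] at h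
    exact inner_self_eq_zero.1 h
  have hf : f ∈ closure (LinearMap.range (LinearMap.id - R) : Set H) := by
    rw [← Submodule.topologicalClosure_coe, htop]; trivial
  obtain ⟨_, ⟨g, rfl⟩, hg⟩ := Metric.mem_closure_iff.1 hf ε hε
  exact ⟨g, by simpa [dist_eq_norm] using hg⟩

/-- For x = g - R g, ‖R^k x‖² is at most the drop from ‖R^k g‖² to ‖R^(k+1) g‖², which tends to 0
since these norms decrease. Such x are dense and the powers of R are contractions. -/
lemma tendsto_pow_apply_zero [CompleteSpace H] {R : H →ₗ[ℝ] H} (hsym : R.IsSymmetric)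
    (hR : ∀ x, ‖R x‖ ^ 2 ≤ inner ℝ (R x) x) (hker : ∀ x, R x = x → x = 0) (x : H) :
    Tendsto (fun k : ℕ => (R ^ k) x) atTop (𝓝 0) := by
  have hle := norm_apply_le_of_norm_sq_le_inner hR
  have hrange : ∀ g, Tendsto (fun k : ℕ => (R ^ k) (g - R g)) atTop (𝓝 0) := by
    intro g
    have hanti : Antitone fun k : ℕ => ‖(R ^ k) g‖ ^ 2 := by
      refine antitone_nat_of_succ_le fun k => ?_
      rw [pow_succ' R, Module.End.mul_apply]
      exact pow_le_pow_left₀ (norm_nonneg _) (hle _) 2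
    have hlim := tendsto_atTop_ciInf hanti ⟨0, by rintro _ ⟨k, rfl⟩; positivity⟩
    have hdiff := hlim.sub ((tendsto_add_atTop_iff_nat 1).2 hlim)
    rw [sub_self] at hdiff
    have hsq : Tendsto (fun k : ℕ => ‖(R ^ k) (g - R g)‖ ^ 2) atTop (𝓝 0) := by
      refine squeeze_zero (fun k => by positivity) (fun k => ?_) hdiff
      have h := norm_sub_apply_sq_le hR ((R ^ k) g)
      rw [← Module.End.mul_apply, ← pow_succ'] at h
      rwa [map_sub, ← Module.End.mul_apply (R ^ k), ← pow_succ]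
    refine tendsto_zero_iff_norm_tendsto_zero.2 ?_
    simpa [Real.sqrt_sq] using hsq.sqrt
  rw [Metric.tendsto_atTop]
  intro ε hε
  obtain ⟨g, hg⟩ := exists_norm_sub_lt_of_symmetric hsym hker x (half_pos hε)
  obtain ⟨N, hN⟩ := Metric.tendsto_atTop.1 (hrange g) (ε / 2) (half_pos hε)
  refine ⟨N, fun k hk => ?_⟩
  have h1 := hN k hk
  have h2 := norm_pow_apply_le hle k (x - (g - R g))
  rw [dist_zero_right] at h1 ⊢
  have h3 : (R ^ k) x = (R ^ k) (x - (g - R g)) + (R ^ k) (g - R g) := by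
    rw [← map_add, sub_add_cancel]
  rw [h3]
  linarith [norm_add_le ((R ^ k) (x - (g - R g))) ((R ^ k) (g - R g))]

/-- Approximate fixed vectors of a symmetric operator without fixed points are weakly null. -/
lemma tendsto_inner_zero_of_approx_fixed [CompleteSpace H] {R : H →ₗ[ℝ] H}
    (hsym : R.IsSymmetric) (hker : ∀ x, R x = x → x = 0) {u : ℕ → H} (hu : ∀ l, ‖u l‖ = 1)
    (hfix : Tendsto (fun l => u l - R (u l)) atTop (𝓝 0)) (f : H) :
    Tendsto (fun l => inner ℝ f (u l)) atTop (𝓝 0) := by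
  rw [Metric.tendsto_atTop]
  intro ε hε
  obtain ⟨g, hg⟩ := exists_norm_sub_lt_of_symmetric hsym hker f (half_pos hε)
  have hlim : Tendsto (fun l => inner ℝ g (u l - R (u l))) atTop (𝓝 0) := by
    simpa using (tendsto_const_nhds (x := g)).inner hfix
  obtain ⟨N, hN⟩ := Metric.tendsto_atTop.1 hlim (ε / 2) (half_pos hε)
  refine ⟨N, fun l hl => ?_⟩
  have h1 := hN l hl
  rw [Real.dist_eq, sub_zero] at h1 ⊢
  have h2 : inner ℝ f (u l) = inner ℝ (f - (g - R g)) (u l) + inner ℝ g (u l - R (u l)) := by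
    rw [inner_sub_right g, ← hsym, ← inner_sub_left, ← inner_add_left, sub_add_cancel]
  have h3 := abs_real_inner_le_norm (f - (g - R g)) (u l)
  rw [hu, mul_one] at h3
  rw [h2]
  linarith [abs_add_le (inner ℝ (f - (g - R g)) (u l)) (inner ℝ g (u l - R (u l)))]

lemma tendsto_sub_pow_apply {R : H →ₗ[ℝ] H} (hle : ∀ x, ‖R x‖ ≤ ‖x‖) {u : ℕ → H}
    (hfix : Tendsto (fun l => u l - R (u l)) atTop (𝓝 0)) (k : ℕ) :
    Tendsto (fun l => u l - (R ^ k) (u l)) atTop (𝓝 0) := by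
  induction k with
  | zero => simp
  | succ k ih =>
    have h : Tendsto (fun l => (R ^ k) (u l - R (u l))) atTop (𝓝 0) :=
      squeeze_zero_norm (fun l => norm_pow_apply_le hle k _)
        (tendsto_zero_iff_norm_tendsto_zero.1 hfix)
    have := ih.add h
    rw [add_zero] at this
    refine this.congr fun l => ?_
    rw [map_sub, ← Module.End.mul_apply (R ^ k), ← pow_succ]
    abel

/-- Adding a small multiple of a late member of a weakly null sequence of approximate fixed
vectors keeps finitely many iterates bounded below. -/
lemma eventually_le_norm_pow_apply_add {R : H →ₗ[ℝ] H} (hle : ∀ x, ‖R x‖ ≤ ‖x‖)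
    {u : ℕ → H} (hu : ∀ l, ‖u l‖ = 1)
    (hfix : Tendsto (fun l => u l - R (u l)) atTop (𝓝 0))
    (hweak : ∀ f, Tendsto (fun l => inner ℝ f (u l)) atTop (𝓝 0))
    (y : H) (N : ℕ) {c : ℝ} (hc : 0 < c) :
    ∀ᶠ l in atTop, ∀ k < N, c / 2 ≤ ‖(R ^ k) (y + c • u l)‖ := by
  suffices h : ∀ k, ∀ᶠ l in atTop, c / 2 ≤ ‖(R ^ k) (y + c • u l)‖ from
    (Finset.eventually_all (Finset.range N)).2 (fun k _ => h k) |>.mono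
      fun l hl k hk => hl k (Finset.mem_range.2 hk)
  intro k
  have h1 := tendsto_sub_pow_apply hle hfix k
  have h1' : Tendsto (fun l => c * ‖u l - (R ^ k) (u l)‖) atTop (𝓝 0) := by
    simpa using (tendsto_zero_iff_norm_tendsto_zero.1 h1).const_mul c
  have h2 : Tendsto (fun l => ‖(R ^ k) y‖ ^ 2 + 2 * (c * inner ℝ ((R ^ k) y) (u l)) + c ^ 2)
      atTop (𝓝 (‖(R ^ k) y‖ ^ 2 + c ^ 2)) := by
    simpa using ((((hweak ((R ^ k) y)).const_mul c).const_mul 2).const_add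
      (‖(R ^ k) y‖ ^ 2)).add_const (c ^ 2)
  -- Near-orthogonality makes ‖R^k y + c u‖ exceed 3c/4; replacing u by R^k u costs less than c/4,
  -- which leaves c/2.
  have h3 : (3 * c / 4) ^ 2 < ‖(R ^ k) y‖ ^ 2 + c ^ 2 := by
    nlinarith [sq_nonneg ‖(R ^ k) y‖, mul_pos hc hc]
  filter_upwards [h1'.eventually (gt_mem_nhds (show (0 : ℝ) < c / 4 by linarith)),
    h2.eventually (lt_mem_nhds h3)] with l hl1 hl2
  have h4 : ‖(R ^ k) y + c • u l‖ ^ 2 =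
      ‖(R ^ k) y‖ ^ 2 + 2 * (c * inner ℝ ((R ^ k) y) (u l)) + c ^ 2 := by
    rw [norm_add_sq_real, real_inner_smul_right, norm_smul, hu, Real.norm_of_nonneg hc.le, mul_one]
  rw [← h4] at hl2
  have h5 := lt_of_pow_lt_pow_left₀ 2 (norm_nonneg _) hl2
  have h6 : (R ^ k) y + c • u l = (R ^ k) (y + c • u l) + c • (u l - (R ^ k) (u l)) := by
    rw [map_add, map_smul, smul_sub]; abel
  have h7 := norm_add_le ((R ^ k) (y + c • u l)) (c • (u l - (R ^ k) (u l)))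
  rw [← h6, norm_smul, Real.norm_of_nonneg hc.le] at h7
  linarith

/-- A contraction with a weakly null sequence of approximate fixed unit vectors has orbits that
decay more slowly than any prescribed null sequence. -/
lemma exists_forall_le_norm_pow_apply [CompleteSpace H] {R : H →ₗ[ℝ] H}
    (hle : ∀ x, ‖R x‖ ≤ ‖x‖) {u : ℕ → H} (hu : ∀ l, ‖u l‖ = 1)
    (hfix : Tendsto (fun l => u l - R (u l)) atTop (𝓝 0))
    (hweak : ∀ f, Tendsto (fun l => inner ℝ f (u l)) atTop (𝓝 0))
    {a : ℕ → ℝ} (ha : Tendsto a atTop (𝓝 0)) :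
    ∃ x, ∀ k, a k ≤ ‖(R ^ k) x‖ := by
  obtain ⟨B, hB⟩ := ha.bddAbove_range
  set b : ℝ := max B 1
  have hb : 0 < b := lt_max_of_lt_right one_pos
  have hab : ∀ k, a k ≤ b := fun k => (hB ⟨k, rfl⟩).trans (le_max_left _ _)
  -- The ratio 1/4 makes the later humps total c n / 3, so the lower bound c n / 2 at stage n
  -- survives in the limit as c n / 6. The factor 6 gives c 0 / 6 = b, which bounds every a k.
  let c : ℕ → ℝ := fun n => 6 * b / 4 ^ n
  have hc : ∀ n, 0 < c n := fun n => by positivity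
  have hN : ∀ n, ∃ N, n < N ∧ ∀ k ≥ N, a k ≤ c (n + 1) / 6 := by
    intro n
    have hpos : 0 < c (n + 1) / 6 := div_pos (hc _) (by norm_num)
    obtain ⟨N, hN⟩ := eventually_atTop.1 (ha.eventually (gt_mem_nhds hpos))
    exact ⟨max N (n + 1), by simp,
      fun k hk => (hN k ((le_max_left _ _).trans hk)).le⟩
  choose N hnN hN using hN
  choose l hl using fun (n : ℕ) (y : H) =>
    (eventually_le_norm_pow_apply_add hle hu hfix hweak y (N n) (hc n)).exists
  let y : ℕ → H := fun n => Nat.rec (c 0 • u (l 0 0))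
    (fun n z => z + c (n + 1) • u (l (n + 1) z)) n
  have hy : ∀ n, ∀ k < N n, c n / 2 ≤ ‖(R ^ k) (y n)‖ := by
    intro n
    cases n with
    | zero =>
      have h := hl 0 0
      simp only [zero_add] at h
      exact h
    | succ n => exact hl (n + 1) (y n)
  have hdist : ∀ n, dist (y n) (y (n + 1)) ≤ 6 * b / 4 * (1 / 4) ^ n := by
    intro n
    have : y (n + 1) = y n + c (n + 1) • u (l (n + 1) (y n)) := rfl
    rw [this, dist_self_add_right, norm_smul, hu, mul_one, Real.norm_of_nonneg (hc _).le]
    refine le_of_eq ?_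
    simp only [c]
    rw [pow_succ, one_div, inv_pow]
    field_simp
  obtain ⟨x, hx⟩ := cauchySeq_tendsto_of_complete
    (cauchySeq_of_le_geometric (1 / 4) (6 * b / 4) (by norm_num) hdist)
  have hxy : ∀ n, ‖y n - x‖ ≤ c n / 3 := by
    intro n
    have h := dist_le_of_le_geometric_of_tendsto (1 / 4) (6 * b / 4) (by norm_num) hdist hx n
    rw [dist_eq_norm] at h
    refine h.trans (le_of_eq ?_)
    simp only [c]
    rw [one_div, inv_pow]
    field_simp
    norm_num
  have hlow : ∀ n, ∀ k < N n, c n / 6 ≤ ‖(R ^ k) x‖ := by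
    intro n k hk
    have h1 := hy n k hk
    have h2 := (norm_pow_apply_le hle k (y n - x)).trans (hxy n)
    rw [map_sub] at h2
    linarith [norm_sub_norm_le ((R ^ k) (y n)) ((R ^ k) x)]
  refine ⟨x, fun k => ?_⟩
  -- At the first stage n with k < N n the orbit is at least c n / 6. If n is a successor, k has
  -- passed the previous threshold, beyond which a ≤ c n / 6.
  have hex : ∃ n, k < N n := ⟨k, hnN k⟩
  have hlt := Nat.find_spec hex
  have hmin : ∀ m < Nat.find hex, N m ≤ k := fun m hm => not_lt.1 (Nat.find_min hex hm)
  generalize Nat.find hex = n at hlt hmin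
  refine le_trans ?_ (hlow n k hlt)
  cases n with
  | zero =>
    refine (hab k).trans (le_of_eq ?_)
    simp only [c]
    ring
  | succ n => exact hN n k (hmin n n.lt_succ_self)

end Contraction

end SimProj

noncomputable section
namespace SimProj

/-! ### Averaging, projections and the error operator -/

section Operators

variable {ι : Type*} {H : Type*} [NormedAddCommGroup H] [InnerProductSpace ℝ H]

@[simp] lemma Hw.sub_apply {ω : Weights ι} (x y : Hw H ω) (i : ι) : (x - y) i = x i - y i := rfl

lemma Hw.norm_sq_eq_tsum {ω : Weights ι} (x : Hw H ω) :
    ‖x‖ ^ 2 = ∑' i, ω.1 i * ‖x i‖ ^ 2 := by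
  rw [← real_inner_self_eq_norm_sq, Hw.inner_def]
  simp_rw [real_inner_self_eq_norm_sq]

/-- The isometric embedding of `H` onto the diagonal of `H_ω`. -/
def diagMap (H : Type*) [NormedAddCommGroup H] [InnerProductSpace ℝ H] (ω : Weights ι) :
    H →ₗ[ℝ] Hw H ω where
  toFun h := ⟨fun _ => h, (Weights.summable ω).mul_right (‖h‖ ^ 2)⟩
  map_add' _ _ := rfl
  map_smul' _ _ := rfl

@[simp] lemma diagMap_apply (ω : Weights ι) (h : H) (i : ι) : diagMap H ω h i = h := rfl

lemma norm_diagMap (ω : Weights ι) (h : H) : ‖diagMap H ω h‖ = ‖h‖ := by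
  rw [← sq_eq_sq₀ (norm_nonneg _) (norm_nonneg _), Hw.norm_sq_eq_tsum]
  simp_rw [diagMap_apply]
  rw [tsum_mul_right, ω.2.2.tsum_eq, one_mul]

lemma mem_diagSubspace_iff {ω : Weights ι} {x : Hw H ω} :
    x ∈ diagSubspace H ω ↔ ∃ h, diagMap H ω h = x :=
  ⟨fun ⟨h, hh⟩ => ⟨h, Subtype.ext (funext fun i => (hh i).symm)⟩,
    fun ⟨h, hh⟩ => ⟨h, fun i => by rw [← hh, diagMap_apply]⟩⟩

lemma diagMap_mem_prodSubspace_iff (M : ι → ClosedSubmodule ℝ H) (ω : Weights ι) {h : H} :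
    diagMap H ω h ∈ prodSubspace M ω ↔ h ∈ (⨅ i, M i) := by
  rw [ClosedSubmodule.mem_iInf]; rfl

variable [CompleteSpace H]

/-- A_ω is the adjoint of the diagonal embedding. -/
lemma inner_averaging (ω : Weights ι) (h : H) (x : Hw H ω) :
    inner ℝ h (averaging ω x) = inner ℝ (diagMap H ω h) x := by
  have hs := (summable_smul_of_bound ω x.2).hasSum.mapL (innerSL ℝ h)
  rw [Hw.inner_def]
  refine hs.tsum_eq.symm.trans (tsum_congr fun i => ?_)
  rw [innerSL_apply_apply, real_inner_smul_right, diagMap_apply]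

variable (M : ι → ClosedSubmodule ℝ H) (ω : Weights ι)

/-- The map `h ↦ (P_{M i} h)`, the projection of the diagonal onto `C_ω`. -/
def projMap : H →ₗ[ℝ] Hw H ω where
  toFun h := ⟨fun i => (M i).toSubmodule.starProjection h,
    Summable.of_nonneg_of_le (fun i => mul_nonneg (Weights.pos ω i).le (sq_nonneg _))
      (fun i => mul_le_mul_of_nonneg_left (pow_le_pow_left₀ (norm_nonneg _)
        ((M i).toSubmodule.norm_starProjection_apply_le h) 2) (Weights.pos ω i).le)
      ((Weights.summable ω).mul_right (‖h‖ ^ 2))⟩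
  map_add' _ _ := Subtype.ext (funext fun _ => map_add _ _ _)
  map_smul' _ _ := Subtype.ext (funext fun _ => map_smul _ _ _)

@[simp] lemma projMap_apply (h : H) (i : ι) :
    projMap M ω h i = (M i).toSubmodule.starProjection h := rfl

lemma averaging_projMap (h : H) : averaging ω (projMap M ω h) = simProj M ω h := rfl

lemma averaging_diagMap (h : H) : averaging ω (diagMap H ω h) = h := by
  refine ext_inner_left ℝ fun v => ?_
  rw [inner_averaging, Hw.inner_def]
  simp_rw [diagMap_apply]
  rw [tsum_mul_right, ω.2.2.tsum_eq, one_mul]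

lemma projMap_mem (h : H) : projMap M ω h ∈ prodSubspace M ω :=
  fun i => (M i).toSubmodule.starProjection_apply_mem h

/-- The map `h ↦ (h - P_{M i} h)`, the projection of the diagonal onto `C_ω^⊥`. -/
def residualMap : H →ₗ[ℝ] Hw H ω := diagMap H ω - projMap M ω

@[simp] lemma residualMap_apply (h : H) (i : ι) :
    residualMap M ω h i = h - (M i).toSubmodule.starProjection h := rfl

lemma residualMap_mem (h : H) : residualMap M ω h ∈ (prodSubspace M ω)ᗮ := by
  rw [Submodule.mem_orthogonal']
  intro x hx
  rw [Hw.inner_def]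
  refine (tsum_congr fun i => ?_).trans tsum_zero
  rw [residualMap_apply, (M i).toSubmodule.starProjection_inner_eq_zero h _ (hx i), mul_zero]

lemma inner_diagMap_of_mem {x : Hw H ω} (hx : x ∈ prodSubspace M ω) (h : H) :
    inner ℝ (diagMap H ω h) x = inner ℝ (projMap M ω h) x := by
  have := (Submodule.mem_orthogonal' _ _).1 (residualMap_mem M ω h) x hx
  rwa [residualMap, LinearMap.sub_apply, inner_sub_left, sub_eq_zero] at this

lemma inner_diagMap_of_mem_orthogonal {x : Hw H ω} (hx : x ∈ (prodSubspace M ω)ᗮ) (h : H) :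
    inner ℝ (diagMap H ω h) x = inner ℝ (residualMap M ω h) x := by
  rw [residualMap, LinearMap.sub_apply, inner_sub_left,
    (Submodule.mem_orthogonal _ _).1 hx _ (projMap_mem M ω h), sub_zero]

/-- This is T_ω = Q*Q: A_ω is adjoint to the diagonal embedding, and against elements of C_ω the
diagonal may be replaced by its projection. -/
lemma inner_simProj (x y : H) :
    inner ℝ (simProj M ω x) y = inner ℝ (projMap M ω x) (projMap M ω y) := by
  rw [real_inner_comm, ← averaging_projMap, inner_averaging,
    inner_diagMap_of_mem M ω (projMap_mem M ω x), real_inner_comm]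

lemma simProj_isSymmetric : (simProj M ω).IsSymmetric := fun x y => by
  rw [inner_simProj, real_inner_comm, ← inner_simProj, real_inner_comm]

lemma averaging_residualMap (h : H) : averaging ω (residualMap M ω h) = h - simProj M ω h := by
  rw [residualMap, LinearMap.sub_apply, map_sub, averaging_diagMap, averaging_projMap]

lemma norm_residualMap_sq (h : H) :
    ‖residualMap M ω h‖ ^ 2 = ‖h‖ ^ 2 - ‖projMap M ω h‖ ^ 2 := by
  rw [residualMap, LinearMap.sub_apply, norm_sub_sq_real,
    inner_diagMap_of_mem M ω (projMap_mem M ω h), real_inner_self_eq_norm_sq, norm_diagMap]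
  ring

lemma norm_projMap_sq (h : H) : ‖projMap M ω h‖ ^ 2 = inner ℝ (simProj M ω h) h := by
  rw [inner_simProj, real_inner_self_eq_norm_sq]

lemma norm_projMap_le (h : H) : ‖projMap M ω h‖ ≤ ‖h‖ := by
  refine (sq_le_sq₀ (norm_nonneg _) (norm_nonneg _)).1 ?_
  linarith [norm_residualMap_sq M ω h, sq_nonneg ‖residualMap M ω h‖]

lemma norm_simProj_sq_le (h : H) :
    ‖simProj M ω h‖ ^ 2 ≤ ‖projMap M ω h‖ * ‖projMap M ω (simProj M ω h)‖ := by
  rw [← real_inner_self_eq_norm_sq, inner_simProj]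
  exact real_inner_le_norm _ _

/-- The operator inequality T² ≤ T: ‖T h‖² ≤ ‖Q h‖ ‖Q T h‖ ≤ ‖Q h‖ ‖T h‖, hence ‖T h‖ ≤ ‖Q h‖. -/
lemma norm_simProj_sq_le_inner (h : H) :
    ‖simProj M ω h‖ ^ 2 ≤ inner ℝ (simProj M ω h) h := by
  rw [← norm_projMap_sq]
  have h1 := norm_simProj_sq_le M ω h
  have h2 := norm_projMap_le M ω (simProj M ω h)
  nlinarith [norm_nonneg (projMap M ω h), norm_nonneg (simProj M ω h),
    sq_nonneg (‖projMap M ω h‖ - ‖simProj M ω h‖),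
    mul_le_mul_of_nonneg_left h2 (norm_nonneg (projMap M ω h))]

lemma residualMap_eq_zero_iff {h : H} : residualMap M ω h = 0 ↔ h ∈ (⨅ i, M i) := by
  rw [ClosedSubmodule.mem_iInf]
  constructor
  · intro h0 i
    have h1 : residualMap M ω h i = 0 := by rw [h0, Hw.zero_apply]
    rw [residualMap_apply, sub_eq_zero] at h1
    exact (Submodule.starProjection_eq_self_iff).1 h1.symm
  · intro hm
    refine Subtype.ext (funext fun i => ?_)
    change residualMap M ω h i = 0
    rw [residualMap_apply, (Submodule.starProjection_eq_self_iff).2 (hm i), sub_self]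

lemma simProj_of_mem {h : H} (hh : h ∈ (⨅ i, M i)) : simProj M ω h = h := by
  have := averaging_residualMap M ω h
  rw [(residualMap_eq_zero_iff M ω).2 hh, map_zero] at this
  exact (sub_eq_zero.1 this.symm).symm

lemma simProj_mem_orthogonal {h : H} (hh : h ∈ (⨅ i, M i).toSubmoduleᗮ) :
    simProj M ω h ∈ (⨅ i, M i).toSubmoduleᗮ := by
  rw [Submodule.mem_orthogonal'] at hh ⊢
  intro m hm
  rw [simProj_isSymmetric, simProj_of_mem M ω hm, hh m hm]

lemma sub_projInter_mem (h : H) : h - projInter M h ∈ (⨅ i, M i).toSubmoduleᗮ :=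
  Submodule.sub_starProjection_mem_orthogonal h

lemma projInter_mem (h : H) : projInter M h ∈ (⨅ i, M i) :=
  Submodule.starProjection_apply_mem _ h

lemma projInter_of_mem_orthogonal {h : H} (hh : h ∈ (⨅ i, M i).toSubmoduleᗮ) :
    projInter M h = 0 :=
  (Submodule.starProjection_apply_eq_zero_iff _).2 hh

lemma norm_sub_projInter_le (h : H) : ‖h - projInter M h‖ ≤ ‖h‖ := by
  have := Submodule.norm_starProjection_apply_le (⨅ i, M i).toSubmoduleᗮ h
  rwa [Submodule.starProjection_orthogonal_val] at this

/-- The error operator `T_ω - P_M`. -/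
def errorMap : H →ₗ[ℝ] H := simProj M ω - (projInter M).toLinearMap

lemma errorMap_apply (h : H) : errorMap M ω h = simProj M ω (h - projInter M h) := by
  rw [map_sub, simProj_of_mem M ω (projInter_mem M h)]; rfl

lemma errorMap_of_mem_orthogonal {h : H} (hh : h ∈ (⨅ i, M i).toSubmoduleᗮ) :
    errorMap M ω h = simProj M ω h := by
  rw [errorMap_apply, projInter_of_mem_orthogonal M hh, sub_zero]

lemma errorMap_mem_orthogonal (h : H) : errorMap M ω h ∈ (⨅ i, M i).toSubmoduleᗮ := by
  rw [errorMap_apply]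
  exact simProj_mem_orthogonal M ω (sub_projInter_mem M h)

lemma errorMap_isSymmetric : (errorMap M ω).IsSymmetric :=
  (simProj_isSymmetric M ω).sub (Submodule.starProjection_isSymmetric _)

lemma norm_errorMap_sq_le_inner (h : H) :
    ‖errorMap M ω h‖ ^ 2 ≤ inner ℝ (errorMap M ω h) h := by
  have h1 : inner ℝ (errorMap M ω h) h = inner ℝ (errorMap M ω h) (h - projInter M h) := by
    rw [inner_sub_right, (Submodule.mem_orthogonal' _ _).1 (errorMap_mem_orthogonal M ω h) _
      (projInter_mem M h), sub_zero]
  rw [h1, errorMap_apply]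
  exact norm_simProj_sq_le_inner M ω _

/-- A fixed vector lies in M^⊥; being fixed by T_ω it has zero residual, so it also lies in M. -/
lemma eq_zero_of_errorMap_eq_self {h : H} (hh : errorMap M ω h = h) : h = 0 := by
  have hperp : h ∈ (⨅ i, M i).toSubmoduleᗮ := hh ▸ errorMap_mem_orthogonal M ω h
  rw [errorMap_of_mem_orthogonal M ω hperp] at hh
  have h1 := norm_residualMap_sq M ω h
  rw [norm_projMap_sq, hh, real_inner_self_eq_norm_sq, sub_self] at h1
  have h2 := (residualMap_eq_zero_iff M ω).1 (norm_eq_zero.1 (pow_eq_zero_iff two_ne_zero |>.1 h1))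
  exact inner_self_eq_zero.1 ((Submodule.mem_orthogonal _ _).1 hperp h h2)

/-- P_M absorbs T_ω, so cross terms vanish. At k = 0 the sides differ by P_M h. -/
lemma errorMap_pow_apply {k : ℕ} (hk : 1 ≤ k) (h : H) :
    (errorMap M ω ^ k) h = (simProj M ω ^ k) h - projInter M h := by
  induction k, hk using Nat.le_induction with
  | base => simp [errorMap]
  | succ k hk ih =>
    have h1 : (errorMap M ω ^ k) h ∈ (⨅ i, M i).toSubmoduleᗮ := by
      obtain ⟨m, rfl⟩ := Nat.exists_eq_add_of_le' hk
      rw [pow_succ', Module.End.mul_apply]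
      exact errorMap_mem_orthogonal M ω _
    rw [pow_succ', Module.End.mul_apply, errorMap_of_mem_orthogonal M ω h1, ih, map_sub,
      simProj_of_mem M ω (projInter_mem M h), pow_succ', Module.End.mul_apply]

lemma norm_errorMap_apply_le (h : H) : ‖errorMap M ω h‖ ≤ ‖h‖ :=
  norm_apply_le_of_norm_sq_le_inner (norm_errorMap_sq_le_inner M ω) h

lemma tendsto_simProj_pow (h : H) :
    Tendsto (fun k : ℕ => (simProj M ω ^ k) h) atTop (𝓝 (projInter M h)) := by
  have h1 := tendsto_pow_apply_zero (errorMap_isSymmetric M ω) (norm_errorMap_sq_le_inner M ω)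
    (fun _ => eq_zero_of_errorMap_eq_self M ω) h
  have h2 := h1.add_const (projInter M h)
  rw [zero_add] at h2
  refine h2.congr' ?_
  filter_upwards [eventually_ge_atTop 1] with k hk
  rw [errorMap_pow_apply M ω hk, sub_add_cancel]

/-- The error operator as a continuous linear map. -/
def errorCLM : H →L[ℝ] H :=
  (errorMap M ω).mkContinuous 1 fun h => by
    rw [one_mul]; exact norm_errorMap_apply_le M ω h

@[simp] lemma errorCLM_apply (h : H) : errorCLM M ω h = errorMap M ω h := rfl

lemma errorCLM_pow_apply (k : ℕ) (h : H) : (errorCLM M ω ^ k) h = (errorMap M ω ^ k) h := by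
  induction k with
  | zero => rfl
  | succ k ih =>
    rw [pow_succ', pow_succ', mul_apply_eq_comp, Module.End.mul_apply, ih,
      errorCLM_apply]

lemma errorCLM_isSelfAdjoint : IsSelfAdjoint (errorCLM M ω) :=
  ContinuousLinearMap.isSelfAdjoint_iff_isSymmetric.2 (errorMap_isSymmetric M ω)

end Operators

/-- The C*-identity settles the exponent 2^k ≥ k; factoring a^(2^k) through a^k and cancelling
‖a‖^(2^k - k) gives exponent k. -/
lemma norm_pow_of_isSelfAdjoint {A : Type*} [NormedRing A] [NormOneClass A] [StarRing A]
    [CStarRing A] {a : A} (ha : IsSelfAdjoint a) (k : ℕ) : ‖a ^ k‖ = ‖a‖ ^ k := by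
  refine le_antisymm (norm_pow_le a k) ?_
  rcases (norm_nonneg a).eq_or_lt with h0 | h0
  · rw [← h0]
    rcases k with _ | k
    · simp
    · simp
  have h1 : ‖a ^ 2 ^ k‖ = ‖a‖ ^ 2 ^ k := by
    have := ha.nnnorm_pow_two_pow k
    exact congrArg NNReal.toReal this
  have hk : k ≤ 2 ^ k := Nat.lt_two_pow_self.le
  have h2 : ‖a‖ ^ k * ‖a‖ ^ (2 ^ k - k) ≤ ‖a ^ k‖ * ‖a‖ ^ (2 ^ k - k) := by
    rw [← pow_add, Nat.add_sub_cancel' hk, ← h1]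
    conv_lhs => rw [← Nat.add_sub_cancel' hk, pow_add]
    exact (norm_mul_le _ _).trans (mul_le_mul_of_nonneg_left (norm_pow_le _ _) (norm_nonneg _))
  exact le_of_mul_le_mul_right h2 (pow_pos h0 _)

end SimProj
end

noncomputable section
namespace SimProj

/-! ### The gap inequality, closedness and the type of convergence -/

section Gap

variable {ι : Type*} {H : Type*} [NormedAddCommGroup H] [InnerProductSpace ℝ H] [CompleteSpace H]
variable (M : ι → ClosedSubmodule ℝ H) (ω : Weights ι)

/-- The weighted squared distances to the `M i` dominate the squared distance to `⨅ i, M i`. -/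
def HasGap : Prop :=
  ∃ c : ℝ, 0 < c ∧ ∀ h ∈ (⨅ i, M i).toSubmoduleᗮ, c * ‖h‖ ^ 2 ≤ ‖residualMap M ω h‖ ^ 2

variable {M ω}

lemma HasGap.of_hasGap (hgap : HasGap M ω) (ω' : Weights ι) : HasGap M ω' := by
  obtain ⟨c, hc, hgap⟩ := hgap
  -- Outside s the ω-mass is below c/2, so the tail uses up at most half of the gap; on s, ω' ≥ δ ω.
  have htail := (tendsto_order.1 ω.2.2).1 (1 - c / 2) (by linarith)
  obtain ⟨s, hs⟩ := htail.exists
  obtain ⟨δ, hδ, hsδ⟩ : ∃ δ : ℝ, 0 < δ ∧ ∀ i ∈ s, δ * ω.1 i ≤ ω'.1 i := by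
    rcases s.eq_empty_or_nonempty with rfl | hne
    · exact ⟨1, one_pos, by simp⟩
    obtain ⟨j, -, hj⟩ := s.exists_min_image (fun i => ω'.1 i / ω.1 i) hne
    exact ⟨ω'.1 j / ω.1 j, div_pos (Weights.pos ω' j) (Weights.pos ω j),
      fun i hi => (le_div_iff₀ (Weights.pos ω i)).1 (hj i hi)⟩
  refine ⟨δ * (c / 2), by positivity, fun h hh => ?_⟩
  set d : ι → ℝ := fun i => ‖h - (M i).toSubmodule.starProjection h‖ ^ 2
  have hd0 : ∀ i, 0 ≤ d i := fun i => sq_nonneg _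
  have hd : ∀ i, d i ≤ ‖h‖ ^ 2 := by
    intro i
    refine pow_le_pow_left₀ (norm_nonneg _) ?_ 2
    have := Submodule.norm_starProjection_apply_le (M i).toSubmoduleᗮ h
    rwa [Submodule.starProjection_orthogonal_val] at this
  have hsum : HasSum (fun i => ω.1 i * d i) (‖residualMap M ω h‖ ^ 2) := by
    rw [Hw.norm_sq_eq_tsum]
    exact (Hw.summable_sq (residualMap M ω h)).hasSum
  have hsum' : HasSum (fun i => ω'.1 i * d i) (‖residualMap M ω' h‖ ^ 2) := by
    rw [Hw.norm_sq_eq_tsum]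
    exact (Hw.summable_sq (residualMap M ω' h)).hasSum
  -- The tail bound comes from comparing a partial sum of the nonnegative series ∑ ω i (‖h‖² - d i)
  -- with its total.
  have h1 : ‖residualMap M ω h‖ ^ 2 - ∑ i ∈ s, ω.1 i * d i ≤
      ‖h‖ ^ 2 * (1 - ∑ i ∈ s, ω.1 i) := by
    have hdiff := (ω.2.2.mul_left (‖h‖ ^ 2)).sub hsum
    have := sum_le_hasSum s (fun i _ => ?_) hdiff
    · rw [Finset.sum_sub_distrib, ← Finset.mul_sum] at this
      linarith
    · nlinarith [Weights.pos ω i, hd i]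
  have h2 : δ * ∑ i ∈ s, ω.1 i * d i ≤ ‖residualMap M ω' h‖ ^ 2 := by
    refine le_trans ?_ (sum_le_hasSum s
      (fun i _ => mul_nonneg (Weights.pos ω' i).le (hd0 i)) hsum')
    rw [Finset.mul_sum]
    refine Finset.sum_le_sum fun i hi => ?_
    rw [← mul_assoc]
    exact mul_le_mul_of_nonneg_right (hsδ i hi) (hd0 i)
  have h3 := hgap h hh
  have h4 : c / 2 * ‖h‖ ^ 2 ≤ ∑ i ∈ s, ω.1 i * d i := by
    nlinarith [sq_nonneg ‖h‖]
  rw [mul_assoc]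
  exact (mul_le_mul_of_nonneg_left h4 hδ.le).trans h2

lemma HasGap.norm_errorCLM_lt_one (hgap : HasGap M ω) : ‖errorCLM M ω‖ < 1 := by
  obtain ⟨c, hc, hgap⟩ := hgap
  -- The maximum covers c > 1, possible only when M^⊥ = 0.
  have hlt : √(max (1 - c) 0) < 1 := by
    rw [Real.sqrt_lt' one_pos, one_pow]
    exact max_lt (by linarith) one_pos
  refine lt_of_le_of_lt (ContinuousLinearMap.opNorm_le_bound _ (Real.sqrt_nonneg _)
    fun h => ?_) hlt
  refine (sq_le_sq₀ (norm_nonneg _) (by positivity)).1 ?_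
  rw [mul_pow, Real.sq_sqrt (le_max_right _ _), errorCLM_apply, errorMap_apply]
  have h1 := norm_simProj_sq_le_inner M ω (h - projInter M h)
  have h2 := norm_residualMap_sq M ω (h - projInter M h)
  rw [norm_projMap_sq] at h2
  have h3 := hgap _ (sub_projInter_mem M h)
  have h4 : ‖h - projInter M h‖ ^ 2 ≤ ‖h‖ ^ 2 :=
    pow_le_pow_left₀ (norm_nonneg _) (norm_sub_projInter_le M h) 2
  calc _ ≤ (1 - c) * ‖h - projInter M h‖ ^ 2 := by linarith
    _ ≤ max (1 - c) 0 * ‖h - projInter M h‖ ^ 2 :=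
      mul_le_mul_of_nonneg_right (le_max_left _ _) (sq_nonneg _)
    _ ≤ _ := mul_le_mul_of_nonneg_left h4 (le_max_right _ _)

variable (M ω) in
lemma goodSet_eq_coe_map :
    goodSet M ω = ((prodSubspace M ω)ᗮ.map (averaging ω) : Submodule ℝ H) := rfl

variable (M ω) in
lemma map_averaging_le :
    (prodSubspace M ω)ᗮ.map (averaging ω) ≤ (⨅ i, M i).toSubmoduleᗮ := by
  rintro _ ⟨x, hx, rfl⟩
  rw [Submodule.mem_orthogonal]
  intro m hm
  rw [inner_averaging]
  exact (Submodule.mem_orthogonal _ _).1 hx _ ((diagMap_mem_prodSubspace_iff M ω).2 hm)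

/-- A Neumann series solves v - R v = h. For h in M^⊥ also v is in M^⊥, and A_ω sends the residual
of v to v - T_ω v = h, so the image is all of M^⊥. -/
lemma HasGap.isClosed_goodSet (hgap : HasGap M ω) : IsClosed (goodSet M ω) := by
  rw [goodSet_eq_coe_map]
  have heq : (prodSubspace M ω)ᗮ.map (averaging ω) = (⨅ i, M i).toSubmoduleᗮ := by
    refine le_antisymm (map_averaging_le M ω) fun h hh => ?_
    obtain ⟨v, hv⟩ := (isUnit_one_sub_of_norm_lt_one hgap.norm_errorCLM_lt_one).exists_right_inv
    have hg : v h - errorMap M ω (v h) = h := by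
      have := DFunLike.congr_fun hv h
      simpa using this
    have hperp : v h ∈ (⨅ i, M i).toSubmoduleᗮ := by
      have := add_mem hh (errorMap_mem_orthogonal M ω (v h))
      rwa [← sub_eq_iff_eq_add.1 hg] at this
    refine ⟨residualMap M ω (v h), residualMap_mem M ω _, ?_⟩
    rw [averaging_residualMap, ← errorMap_of_mem_orthogonal M ω hperp, hg]
  rw [heq]
  exact Submodule.isClosed_orthogonal _

/-- If x is orthogonal to the image, pairing it with A_ω of its own residual gives a zero residual,
so x is in M. A closed subspace equals its double complement. -/
lemma map_averaging_eq_of_isClosed (hcl : IsClosed (goodSet M ω)) :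
    (prodSubspace M ω)ᗮ.map (averaging ω) = (⨅ i, M i).toSubmoduleᗮ := by
  rw [goodSet_eq_coe_map] at hcl
  refine le_antisymm (map_averaging_le M ω) ?_
  have : CompleteSpace ((prodSubspace M ω)ᗮ.map (averaging ω) : Submodule ℝ H) :=
    hcl.completeSpace_coe
  rw [← Submodule.orthogonal_orthogonal ((prodSubspace M ω)ᗮ.map (averaging ω))]
  refine Submodule.orthogonal_le fun x hx => ?_
  refine (residualMap_eq_zero_iff M ω).1 ?_
  have h := (Submodule.mem_orthogonal' _ _).1 hx _ ⟨_, residualMap_mem M ω x, rfl⟩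
  rw [inner_averaging, inner_diagMap_of_mem_orthogonal M ω (residualMap_mem M ω x)] at h
  exact inner_self_eq_zero.1 h

lemma hasGap_of_isClosed_goodSet (hcl : IsClosed (goodSet M ω)) : HasGap M ω := by
  have hmap := map_averaging_eq_of_isClosed hcl
  -- Uniform boundedness of g / ‖residual of g‖ is the gap. Surjectivity onto M^⊥ gives the
  -- pointwise bounds: if h - P_M h = A_ω y, then ⟨g, h⟩ = ⟨residual of g, y⟩. A zero residual
  -- yields the zero functional.
  let φ : (⨅ i, M i).toSubmoduleᗮ → H →L[ℝ] ℝ := fun g =>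
    ‖residualMap M ω (g : H)‖⁻¹ • innerSL ℝ (g : H)
  obtain ⟨C, hC⟩ : ∃ C, ∀ g, ‖φ g‖ ≤ C := by
    refine banach_steinhaus fun h => ?_
    obtain ⟨y, hy, hyh⟩ : h - projInter M h ∈ (prodSubspace M ω)ᗮ.map (averaging ω) :=
      hmap ▸ sub_projInter_mem M h
    refine ⟨‖y‖, fun g => ?_⟩
    have h1 : inner ℝ (g : H) h = inner ℝ (residualMap M ω (g : H)) y := by
      rw [← inner_diagMap_of_mem_orthogonal M ω hy, ← inner_averaging, hyh, inner_sub_right,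
        (Submodule.mem_orthogonal' _ _).1 g.2 _ (projInter_mem M h), sub_zero]
    have h2 : ‖inner ℝ (g : H) h‖ ≤ ‖residualMap M ω (g : H)‖ * ‖y‖ := by
      rw [h1]; exact norm_inner_le_norm _ _
    change ‖‖residualMap M ω (g : H)‖⁻¹ • inner ℝ (g : H) h‖ ≤ ‖y‖
    rw [norm_smul, norm_inv, norm_norm]
    rcases (norm_nonneg (residualMap M ω (g : H))).eq_or_lt with h0 | h0
    · rw [← h0]; simp
    · rwa [inv_mul_le_iff₀ h0]
  have hC0 : 0 ≤ C := (norm_nonneg _).trans (hC 0)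
  -- C may be 0; C + 1 keeps the constant positive.
  refine ⟨((C + 1) ^ 2)⁻¹, by positivity, fun g hg => ?_⟩
  have h1 : ‖residualMap M ω g‖⁻¹ * ‖g‖ ≤ C := by
    have := hC ⟨g, hg⟩
    simpa only [φ, norm_smul, norm_inv, norm_norm, innerSL_apply_norm] using this
  have h2 : ‖g‖ ≤ (C + 1) * ‖residualMap M ω g‖ := by
    rcases (norm_nonneg (residualMap M ω g)).eq_or_lt with h0 | h0
    · have h3 := (residualMap_eq_zero_iff M ω).1 (norm_eq_zero.1 h0.symm)
      rw [inner_self_eq_zero.1 ((Submodule.mem_orthogonal _ _).1 hg g h3)]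
      simp
    · rw [inv_mul_le_iff₀ h0] at h1
      linarith
  rw [inv_mul_le_iff₀ (by positivity), ← mul_pow]
  exact pow_le_pow_left₀ (norm_nonneg _) h2 2

lemma isClosed_goodSet_iff : IsClosed (goodSet M ω) ↔ HasGap M ω :=
  ⟨hasGap_of_isClosed_goodSet, HasGap.isClosed_goodSet⟩

lemma HasGap.convergesLinearly (hgap : HasGap M ω) :
    ConvergesLinearly (simProj M ω) (projInter M).toLinearMap := by
  refine ⟨1, one_pos, max ‖errorCLM M ω‖ (1 / 2), by positivity,
    max_lt hgap.norm_errorCLM_lt_one (by norm_num), fun k hk x => ?_⟩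
  rw [ContinuousLinearMap.coe_coe, ← errorMap_pow_apply M ω hk, ← errorCLM_pow_apply, one_mul]
  refine (ContinuousLinearMap.le_opNorm _ _).trans
    (mul_le_mul_of_nonneg_right ?_ (norm_nonneg x))
  exact (norm_pow_le' _ hk).trans (pow_le_pow_left₀ (norm_nonneg _) (le_max_left _ _) k)

/-- Normalized counterexamples to the gap with constants 1/(l+1); then ‖u - T u‖² ≤ ‖u‖² - ⟨T u, u⟩
is the squared residual. -/
lemma exists_approx_fixed_of_not_hasGap (hgap : ¬ HasGap M ω) :
    ∃ u : ℕ → H, (∀ l, ‖u l‖ = 1) ∧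
      Tendsto (fun l => u l - errorMap M ω (u l)) atTop (𝓝 0) := by
  have hex : ∀ l : ℕ, ∃ u ∈ (⨅ i, M i).toSubmoduleᗮ, ‖u‖ = 1 ∧
      ‖residualMap M ω u‖ ^ 2 ≤ 1 / ((l : ℝ) + 1) := by
    intro l
    by_contra! hcon
    refine hgap ⟨1 / ((l : ℝ) + 1), by positivity, fun h hh => ?_⟩
    rcases eq_or_ne h 0 with rfl | h0
    · simp
    have hn : 0 < ‖h‖ := norm_pos_iff.2 h0
    have h1 := (hcon (‖h‖⁻¹ • h) (Submodule.smul_mem _ _ hh)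
      (by rw [norm_smul, norm_inv, norm_norm, inv_mul_cancel₀ hn.ne'])).le
    rw [map_smul, norm_smul, norm_inv, norm_norm, inv_mul_eq_div, div_pow,
      le_div_iff₀ (by positivity)] at h1
    exact h1
  choose u hu hu1 hu2 using hex
  refine ⟨u, hu1, ?_⟩
  have hsq : Tendsto (fun l => ‖u l - errorMap M ω (u l)‖ ^ 2) atTop (𝓝 0) := by
    refine squeeze_zero (fun _ => sq_nonneg _) (fun l => ?_)
      tendsto_one_div_add_atTop_nhds_zero_nat
    refine le_trans ?_ (hu2 l)
    rw [errorMap_of_mem_orthogonal M ω (hu l), norm_residualMap_sq, norm_projMap_sq,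
      norm_sub_sq_real, real_inner_comm]
    linarith [norm_simProj_sq_le_inner M ω (u l)]
  refine tendsto_zero_iff_norm_tendsto_zero.2 ?_
  simpa [Real.sqrt_sq] using hsq.sqrt

lemma convergesArbitrarilySlowly_of_not_hasGap (hgap : ¬ HasGap M ω) :
    ConvergesArbitrarilySlowly (simProj M ω) (projInter M).toLinearMap := by
  refine ⟨tendsto_simProj_pow M ω, fun a _ ha => ?_⟩
  obtain ⟨u, hu, hfix⟩ := exists_approx_fixed_of_not_hasGap hgap
  obtain ⟨x, hx⟩ := exists_forall_le_norm_pow_apply (norm_errorMap_apply_le M ω) hu hfix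
    (tendsto_inner_zero_of_approx_fixed (errorMap_isSymmetric M ω)
      (fun _ => eq_zero_of_errorMap_eq_self M ω) hu hfix) ha
  refine ⟨x, fun k hk => ?_⟩
  rw [ContinuousLinearMap.coe_coe, ← errorMap_pow_apply M ω hk]
  exact hx k

omit [CompleteSpace H] in
lemma ConvergesLinearly.not_convergesArbitrarilySlowly {T P : H →ₗ[ℝ] H}
    (hlin : ConvergesLinearly T P) : ¬ ConvergesArbitrarilySlowly T P := by
  rintro ⟨-, hslow⟩
  obtain ⟨c, hc, q, hq0, hq1, hlin⟩ := hlin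
  have hr0 : 0 < √q := Real.sqrt_pos.2 hq0
  have hr1 : √q < 1 := (Real.sqrt_lt' one_pos).2 (by simpa using hq1)
  have hlim := tendsto_pow_atTop_nhds_zero_of_lt_one hr0.le hr1
  -- The null sequence √q^k beats the linear rate: it would force 1 ≤ c ‖x‖ √q^k for all k ≥ 1.
  obtain ⟨x, hx⟩ := hslow (fun k => √q ^ k) (fun k => by positivity) hlim
  have hlim' := hlim.const_mul (c * ‖x‖)
  rw [mul_zero] at hlim'
  obtain ⟨k, hk, hk1⟩ := ((hlim'.eventually (gt_mem_nhds one_pos)).and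
    (eventually_ge_atTop 1)).exists
  have h1 := (hx k hk1).trans (hlin k hk1 x)
  have h2 : q ^ k = √q ^ k * √q ^ k := by rw [← mul_pow, Real.mul_self_sqrt hq0.le]
  have h3 : 0 < √q ^ k := pow_pos hr0 k
  rw [h2] at h1
  nlinarith

end Gap

/-! ### The Friedrichs cosine as an operator norm -/

section FriedrichsAngle

variable {ι : Type*} {H : Type*} [NormedAddCommGroup H] [InnerProductSpace ℝ H] [CompleteSpace H]
variable (M : ι → ClosedSubmodule ℝ H) (ω : Weights ι)

omit [CompleteSpace H] in
lemma mem_inf_diagSubspace_iff {x : Hw H ω} :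
    x ∈ prodSubspace M ω ⊓ diagSubspace H ω ↔ ∃ m ∈ (⨅ i, M i), diagMap H ω m = x := by
  rw [Submodule.mem_inf, mem_diagSubspace_iff]
  constructor
  · rintro ⟨hx, m, rfl⟩
    exact ⟨m, (diagMap_mem_prodSubspace_iff M ω).1 hx, rfl⟩
  · rintro ⟨m, hm, rfl⟩
    exact ⟨(diagMap_mem_prodSubspace_iff M ω).2 hm, m, rfl⟩

lemma diagMap_mem_orthogonal_iff {h : H} :
    diagMap H ω h ∈ (prodSubspace M ω ⊓ diagSubspace H ω)ᗮ ↔ h ∈ (⨅ i, M i).toSubmoduleᗮ := by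
  have key : ∀ m, inner ℝ (diagMap H ω m) (diagMap H ω h) = inner ℝ m h := fun m => by
    rw [← inner_averaging, averaging_diagMap]
  rw [Submodule.mem_orthogonal, Submodule.mem_orthogonal]
  constructor
  · intro hh m hm
    rw [← key]
    exact hh _ ((mem_inf_diagSubspace_iff M ω).2 ⟨m, hm, rfl⟩)
  · intro hh x hx
    obtain ⟨m, hm, rfl⟩ := (mem_inf_diagSubspace_iff M ω).1 hx
    rw [key]
    exact hh m hm

lemma projMap_mem_orthogonal {h : H} (hh : h ∈ (⨅ i, M i).toSubmoduleᗮ) :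
    projMap M ω h ∈ (prodSubspace M ω ⊓ diagSubspace H ω)ᗮ := by
  rw [Submodule.mem_orthogonal']
  intro x hx
  rw [← inner_diagMap_of_mem M ω hx.1]
  exact (Submodule.mem_orthogonal' _ _).1 ((diagMap_mem_orthogonal_iff M ω).2 hh) x hx

lemma bddAbove_friedrichsCos {E : Type*} [NormedAddCommGroup E] [InnerProductSpace ℝ E]
    (U V : Submodule ℝ E) :
    BddAbove {t : ℝ | ∃ x ∈ U ⊓ (U ⊓ V)ᗮ, ∃ y ∈ V ⊓ (U ⊓ V)ᗮ,
      ‖x‖ ≤ 1 ∧ ‖y‖ ≤ 1 ∧ t = inner ℝ x y} := by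
  refine ⟨1, ?_⟩
  rintro _ ⟨x, -, y, -, hx, hy, rfl⟩
  exact (real_inner_le_norm x y).trans (mul_le_one₀ hx (norm_nonneg _) hy)

lemma friedrichsCos_nonneg {E : Type*} [NormedAddCommGroup E] [InnerProductSpace ℝ E]
    (U V : Submodule ℝ E) : 0 ≤ friedrichsCos U V :=
  le_csSup (bddAbove_friedrichsCos U V) ⟨0, zero_mem _, 0, zero_mem _, by simp⟩

/-- The normalized pair of Q h and the diagonal of h competes in the supremum, with inner product ‖Q
h‖ / ‖h‖. -/
lemma norm_projMap_le_friedrichsCos {h : H} (hh : h ∈ (⨅ i, M i).toSubmoduleᗮ) :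
    ‖projMap M ω h‖ ≤ friedrichsCos (prodSubspace M ω) (diagSubspace H ω) * ‖h‖ := by
  rcases eq_or_ne (projMap M ω h) 0 with h0 | h0
  · rw [h0, norm_zero]
    exact mul_nonneg (friedrichsCos_nonneg _ _) (norm_nonneg _)
  have hn : 0 < ‖projMap M ω h‖ := norm_pos_iff.2 h0
  have hh0 : 0 < ‖h‖ := hn.trans_le (norm_projMap_le M ω h)
  rw [← div_le_iff₀ hh0]
  refine le_csSup (bddAbove_friedrichsCos _ _)
    ⟨‖projMap M ω h‖⁻¹ • projMap M ω h, Submodule.smul_mem _ _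
      ⟨projMap_mem M ω h, projMap_mem_orthogonal M ω hh⟩, ‖h‖⁻¹ • diagMap H ω h,
      Submodule.smul_mem _ _ ⟨mem_diagSubspace_iff.2 ⟨h, rfl⟩,
        (diagMap_mem_orthogonal_iff M ω).2 hh⟩, ?_, ?_, ?_⟩
  · rw [norm_smul, norm_inv, norm_norm, inv_mul_cancel₀ hn.ne']
  · rw [norm_smul, norm_inv, norm_norm, norm_diagMap, inv_mul_cancel₀ hh0.ne']
  · rw [real_inner_smul_left, real_inner_smul_right, real_inner_comm,
      inner_diagMap_of_mem M ω (projMap_mem M ω h), real_inner_self_eq_norm_sq]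
    field_simp

/-- Upper bound: ‖T g‖² ≤ ‖Q g‖ ‖Q T g‖ ≤ γ² ‖g‖ ‖T g‖ on M^⊥. Lower bound: a competitor is at most
‖Q h‖ = ⟨R h, h⟩^(1/2) ≤ ‖R‖^(1/2). -/
lemma norm_errorCLM_eq :
    ‖errorCLM M ω‖ = friedrichsCos (prodSubspace M ω) (diagSubspace H ω) ^ 2 := by
  set γ := friedrichsCos (prodSubspace M ω) (diagSubspace H ω) with hγ
  have hγ0 : 0 ≤ γ := friedrichsCos_nonneg _ _
  refine le_antisymm (ContinuousLinearMap.opNorm_le_bound _ (sq_nonneg _) fun h => ?_) ?_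
  · rw [errorCLM_apply, errorMap_apply]
    have hg := sub_projInter_mem M h
    refine le_trans ?_ (mul_le_mul_of_nonneg_left (norm_sub_projInter_le M h) (sq_nonneg γ))
    set g := h - projInter M h
    have h1 := norm_simProj_sq_le M ω g
    have h2 := mul_le_mul (norm_projMap_le_friedrichsCos M ω hg)
      (norm_projMap_le_friedrichsCos M ω (simProj_mem_orthogonal M ω hg)) (norm_nonneg _)
      (mul_nonneg hγ0 (norm_nonneg _))
    rcases (norm_nonneg (simProj M ω g)).eq_or_lt with h0 | h0
    · rw [← h0]; positivity
    · refine le_of_mul_le_mul_right ?_ h0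
      rw [← hγ] at h2
      linarith
  · rw [← Real.sqrt_le_sqrt_iff (norm_nonneg _), Real.sqrt_sq hγ0]
    refine csSup_le ⟨0, 0, zero_mem _, 0, zero_mem _, by simp⟩ ?_
    rintro _ ⟨x, ⟨hxC, -⟩, y, ⟨hyD, hy⟩, hx1, hy1, rfl⟩
    obtain ⟨h, rfl⟩ := mem_diagSubspace_iff.1 hyD
    rw [norm_diagMap] at hy1
    have hh := (diagMap_mem_orthogonal_iff M ω).1 hy
    rw [real_inner_comm, inner_diagMap_of_mem M ω hxC]
    refine (real_inner_le_norm _ _).trans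
      ((mul_le_of_le_one_right (norm_nonneg _) hx1).trans (Real.le_sqrt_of_sq_le ?_))
    rw [norm_projMap_sq, ← errorMap_of_mem_orthogonal M ω hh, ← errorCLM_apply]
    calc _ ≤ ‖errorCLM M ω h‖ * ‖h‖ := real_inner_le_norm _ _
      _ ≤ ‖errorCLM M ω h‖ * 1 := mul_le_mul_of_nonneg_left hy1 (norm_nonneg _)
      _ = ‖errorCLM M ω h‖ := mul_one _
      _ ≤ ‖errorCLM M ω‖ := (errorCLM M ω).unit_le_opNorm h hy1

lemma isLeast_friedrichsCos_pow [Nontrivial H] {k : ℕ} (hk : 1 ≤ k) :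
    IsLeast {c : ℝ | ∀ x : H, ‖(simProj M ω ^ k) x - projInter M x‖ ≤ c * ‖x‖}
      (friedrichsCos (prodSubspace M ω) (diagSubspace H ω) ^ (2 * k)) := by
  rw [pow_mul, ← norm_errorCLM_eq, ← norm_pow_of_isSelfAdjoint (errorCLM_isSelfAdjoint M ω)]
  have key : ∀ x, (simProj M ω ^ k) x - projInter M x = (errorCLM M ω ^ k) x := fun x => by
    rw [errorCLM_pow_apply, errorMap_pow_apply M ω hk]
  simp_rw [key]
  refine ⟨fun x => (errorCLM M ω ^ k).le_opNorm x, fun c hc => ?_⟩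
  -- A nonzero vector forces c ≥ 0; in the zero space every real c is admissible and there is no
  -- least one.
  obtain ⟨x, hx⟩ := exists_ne (0 : H)
  have hc0 : 0 ≤ c :=
    nonneg_of_mul_nonneg_left ((norm_nonneg _).trans (hc x)) (norm_pos_iff.2 hx)
  exact ContinuousLinearMap.opNorm_le_bound _ hc0 hc

end FriedrichsAngle

/-- Without any weights both cases would hold vacuously and exclusivity would fail. -/
lemma nonempty_weights (ι : Type*) [Nonempty ι] [Countable ι] : Nonempty (Weights ι) := by
  have := Encodable.ofCountable ι
  obtain ⟨ε, hε, s, hs, -⟩ := posSumOfEncodable one_pos ι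
  have hs0 : 0 < s := by
    obtain ⟨i⟩ := ‹Nonempty ι›
    exact (hε i).trans_le (le_hasSum hs i fun j _ => (hε j).le)
  refine ⟨⟨fun i => ε i / s, fun i => div_pos (hε i) hs0, ?_⟩⟩
  simpa [hs0.ne'] using hs.div_const s

end SimProj
end

theorem mainTheorem2 {H : Type*} [NormedAddCommGroup H] [InnerProductSpace ℝ H] [CompleteSpace H]
    {ι : Type*} [Nonempty ι] [Countable ι]
    (M : ι → ClosedSubmodule ℝ H) (hM : ∀ i, M i ≠ ⊥) :
    -- exactly one of the two cases holds
    Xor (∀ ω : SimProj.Weights ι, IsClosed (SimProj.goodSet M ω))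
      (∀ ω : SimProj.Weights ι, ¬ IsClosed (SimProj.goodSet M ω)) ∧
    -- in the first case, linear convergence with the optimal error bound
    ((∀ ω : SimProj.Weights ι, IsClosed (SimProj.goodSet M ω)) →
      ∀ ω : SimProj.Weights ι,
        SimProj.ConvergesLinearly (SimProj.simProj M ω) (SimProj.projInter M).toLinearMap ∧
        ∀ k : ℕ, 1 ≤ k →
          IsLeast {c : ℝ | ∀ x : H,
              ‖(SimProj.simProj M ω ^ k) x - SimProj.projInter M x‖ ≤ c * ‖x‖}
            (SimProj.friedrichsCos (SimProj.prodSubspace M ω)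
              (SimProj.diagSubspace H ω) ^ (2 * k))) ∧
    -- in the second case, arbitrarily slow convergence
    ((∀ ω : SimProj.Weights ι, ¬ IsClosed (SimProj.goodSet M ω)) →
      ∀ ω : SimProj.Weights ι,
        SimProj.ConvergesArbitrarilySlowly (SimProj.simProj M ω)
          (SimProj.projInter M).toLinearMap) ∧
    -- the type of convergence does not depend on the weights
    Xor
      (∀ ω : SimProj.Weights ι,
        SimProj.ConvergesLinearly (SimProj.simProj M ω) (SimProj.projInter M).toLinearMap)
      (∀ ω : SimProj.Weights ι,
        SimProj.ConvergesArbitrarilySlowly (SimProj.simProj M ω)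
          (SimProj.projInter M).toLinearMap) := by
  obtain ⟨i₀⟩ := ‹Nonempty ι›
  have : Nontrivial H := by
    by_contra hH
    rw [not_nontrivial_iff_subsingleton] at hH
    refine hM i₀ (SetLike.ext fun x => ?_)
    rw [Subsingleton.elim x 0]
    exact ⟨fun _ => zero_mem _, fun _ => zero_mem _⟩
  have : Nonempty ι := ⟨i₀⟩
  obtain ⟨ω₀⟩ := SimProj.nonempty_weights ι
  -- The gap for one reference weight decides closedness for all weights at once.
  have hcl : ∀ ω, IsClosed (SimProj.goodSet M ω) ↔ SimProj.HasGap M ω₀ := fun ω =>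
    SimProj.isClosed_goodSet_iff.trans ⟨fun h => h.of_hasGap ω₀, fun h => h.of_hasGap ω⟩
  have hlin : SimProj.HasGap M ω₀ → ∀ ω : SimProj.Weights ι,
      SimProj.ConvergesLinearly (SimProj.simProj M ω) (SimProj.projInter M).toLinearMap :=
    fun h ω => (h.of_hasGap ω).convergesLinearly
  have hslow : ¬ SimProj.HasGap M ω₀ → ∀ ω : SimProj.Weights ι,
      SimProj.ConvergesArbitrarilySlowly (SimProj.simProj M ω)
        (SimProj.projInter M).toLinearMap :=
    fun h ω => SimProj.convergesArbitrarilySlowly_of_not_hasGap fun h' => h (h'.of_hasGap ω₀)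
  refine ⟨?_, fun h ω => ⟨hlin ((hcl ω₀).1 (h ω₀)) ω,
    fun k hk => SimProj.isLeast_friedrichsCos_pow M ω hk⟩,
    fun h => hslow fun hgap => h ω₀ ((hcl ω₀).2 hgap), ?_⟩
  · by_cases hgap : SimProj.HasGap M ω₀
    · exact Or.inl ⟨fun ω => (hcl ω).2 hgap, fun h => h ω₀ ((hcl ω₀).2 hgap)⟩
    · exact Or.inr ⟨fun ω h => hgap ((hcl ω).1 h), fun h => hgap ((hcl ω₀).1 (h ω₀))⟩
  · by_cases hgap : SimProj.HasGap M ω₀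
    · exact Or.inl ⟨hlin hgap, fun h => (hlin hgap ω₀).not_convergesArbitrarilySlowly (h ω₀)⟩
    · exact Or.inr ⟨hslow hgap, fun h => (h ω₀).not_convergesArbitrarilySlowly (hslow hgap ω₀)⟩
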